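/- **Definitions.** A *polymatroid* $(E,f)$ is a set $E$ with a function $f:\mathcal P(E)\to\mathbb R$ that satisfies $f(\emptyset)=0$, is monotone, and satisfies $f(A)+f(B)\ge f(A\cup B)+f(A\cap B)$ for all $A,B\subseteq E$. Write $f(a_1,\dots,a_k)=f(\{a_1,\dots,a_k\})$ and $\mathrm{cl}(A)=\{x\in E: f(A\cup\{x\})=f(A)\}$. It is of *finite type* if $f(A)=\sup\{f(F): F\subseteq A \text{ finite}\}$ for all $A\subseteq E$. It is *entropic* if there are random variables $(X_i)_{i\in E}$ on a finite probability space such that $f(A)$ is the Shannon entropy (base $2$) of $(X_i)_{i\in A}$ for every $A\subseteq E$. It is *almost entropic* if it is of finite type and there is a sequence of entropic polymatroids on $E$ that converges to $f$ pointwise on $\mathcal P(E)$. A *partial Dowling geometry* (PDG) of rank $r$ is a triple $(E,f,S)$, where $(E,f)$ is a polymatroid and $S$ is a set (the generating set) with an involution $s\mapsto s^{-1}$ and a distinguished element $e=e^{-1}$, such that: 1. $E=\{b_1,\dots,b_r\}\sqcup\bigsqcup_{1\le i<j\le r}\{s_{i,j}: s\in S\}$ is a disjoint union of $r$ distinct elements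 $b_1,\dots,b_r$ and of $\binom r2$ copies of $S$; for $i<j$ put $s_{j,i}:=(s^{-1})_{i,j}$; 2. $f(A)=|A|$ for every $A\subseteq\{b_1,\dots,b_r\}$; 3. $s_{i,j}\in\mathrm{cl}(\{b_i,b_j\})$, $f(s_{i,j})=1$ and $f(b_i,s_{i,j})=2$ for all $s\in S$ and all distinct $i,j$; 4. $f(s_{i,j},(s^{-1})_{j,k},e_{k,i})=2$ for all $s\in S$ and all distinct $i,j,k$. It is called almost entropic if $(E,f)$ is almost entropic. A triple $(s,s',s'')\in S^3$ is a *relator* if $f(s_{i,j},s'_{j,k},s''_{k,i})=2$ for all distinct $i,j,k$. An element $t\in S$ is a *geometric product* of $s,s'\in S$ if $(s,s',t^{-1})$ is a relator; the PDG is *closed under geometric products* if every $s,s'\in S$ have a geometric product in $S$. Elements $t,t'\in S$ are *parallel*, $t\sim t'$, if $t'_{i,j}\in\mathrm{cl}(\{t_{i,j}\})$ for some distinct $i,j$. **Theorem.** Let $(E,f,S)$ be an almost entropic PDG of rank $4$ that is closed under geometric products. Then $\sim$ is an equivalence relation on $S$, and the geometric product descends to a well-defined operation on the set $S/{\sim}$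 of parallelism classes: there is an operation $\cdot$ on $S/{\sim}$ such that, for all $s,s',t\in S$, $t$ is a geometric product of $s$ and $s'$ if and only if $[s]\cdot[s']=[t]$. With this operation $S/{\sim}$ is a group, and $[s]^{-1}=[s^{-1}]$ for every $s\in S$. -/

import Mathlib

open Filter Topology

/-- A polymatroid on the (possibly infinite) ground set `E`. -/
structure Polymatroid (E : Type*) where
  /-- The rank function. -/
  rk : Set E → ℝ
  rk_empty : rk ∅ = 0
  rk_mono : ∀ A B : Set E, A ⊆ B → rk A ≤ rk B
  rk_submodular : ∀ A B : Set E, rk (A ∪ B) + rk (A ∩ B) ≤ rk A + rk B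

namespace Polymatroid

/-- The closure operator: `x ∈ cl A` iff adding `x` to `A` does not change the rank. -/
def cl {E : Type*} (M : Polymatroid E) (A : Set E) : Set E :=
  {x | M.rk A = M.rk (A ∪ {x})}

/-- `M` is of finite type: the rank of a set is the supremum of the ranks of its finite subsets.
(This holds automatically when `E` is finite.) -/
def IsFiniteType {E : Type*} (M : Polymatroid E) : Prop :=
  ∀ A : Set E, IsLUB {x : ℝ | ∃ F : Set E, F.Finite ∧ F ⊆ A ∧ x = M.rk F} (M.rk A)

end Polymatroid

open Classical in
/-- `P(Y = y)` on the finite probability space `Ω` with weights `p`. -/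
noncomputable def probEq {Ω α : Type*} [Fintype Ω] (p : Ω → ℝ) (Y : Ω → α) (y : α) : ℝ :=
  ∑ ω with Y ω = y, p ω

open Classical in
/-- The Shannon entropy, in bits, of the random variable `Y` on the finite probability space `Ω`
with weights `p`. Values outside the image of `Y` have probability `0` and contribute nothing, so
the sum runs over the image only. -/
noncomputable def shannonEntropy {Ω α : Type*} [Fintype Ω] (p : Ω → ℝ) (Y : Ω → α) : ℝ :=
  ∑ y ∈ Finset.univ.image Y, probEq p Y y * Real.logb 2 (1 / probEq p Y y)

/-- `h` is entropic: there are random variables `(X i)` for `i : E` on a finite probability space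
such that `h A` is the joint entropy of the subfamily indexed by `A`, for every `A ⊆ E`. -/
def IsEntropic {E : Type*} (h : Set E → ℝ) : Prop :=
  ∃ (Ω : Type) (_ : Fintype Ω) (p : Ω → ℝ) (codom : E → Type) (X : ∀ i : E, Ω → codom i),
    p ∈ stdSimplex ℝ Ω ∧
      ∀ A : Set E, h A = shannonEntropy p (fun (ω : Ω) (i : A) => X i ω)

/-- A polymatroid is almost entropic if it is of finite type and it is the pointwise limit of a
sequence of entropic polymatroids on the same ground set. -/
def Polymatroid.IsAlmostEntropic {E : Type*} (M : Polymatroid E) : Prop :=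
  M.IsFiniteType ∧
    ∃ h : ℕ → Set E → ℝ, (∀ n, IsEntropic (h n)) ∧
      ∀ A : Set E, Tendsto (fun n => h n A) atTop (𝓝 (M.rk A))

/-- The set-theoretic data of a partial Dowling geometry of rank `r`: a generating set `S` with an
involution and a distinguished element, and a ground set `E` which is the disjoint union of
`{b₁, …, b_r}` and of one copy of `S` for each pair of indices `i < j`. -/
structure DowlingFrame (r : ℕ) (E S : Type*) where
  /-- The involution `s ↦ s⁻¹` of the generating set. -/
  inv : S → S
  inv_involutive : Function.Involutive inv
  /-- The distinguished element of the generating set. -/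
  e : S
  inv_e : inv e = e
  /-- The distinguished basis. -/
  b : Fin r → E
  /-- `copy ((i, j), s)` is the element `s_{i,j}` of the ground set, for `i < j`. -/
  copy : {q : Fin r × Fin r // q.1 < q.2} × S → E
  /-- The elements `b i` and `s_{i,j}` (`i < j`) are pairwise distinct and exhaust `E`. -/
  bijective_elim : Function.Bijective (Sum.elim b copy)

/-- The element `s_{i,j}` for arbitrary distinct indices: for `j < i` it is `(s⁻¹)_{j,i}`. -/
def DowlingFrame.pt {r : ℕ} {E S : Type*} (D : DowlingFrame r E S)
    (i j : Fin r) (hij : i ≠ j) (s : S) : E :=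
  if h : i < j then D.copy (⟨(i, j), h⟩, s)
  else D.copy (⟨(j, i), lt_of_le_of_ne (not_lt.mp h) hij.symm⟩, D.inv s)

/-- A partial Dowling geometry (PDG) of rank `r` with ground set `E` and generating set `S`. -/
structure PartialDowlingGeometry (r : ℕ) (E S : Type*) extends
    Polymatroid E, DowlingFrame r E S where
  /-- The distinguished basis is independent. -/
  rk_basis : ∀ A : Set E, A ⊆ Set.range b → rk A = (A.ncard : ℝ)
  /-- `s_{i,j}` lies on the line spanned by `b i` and `b j`. -/
  pt_mem_cl : ∀ (s : S) (i j : Fin r) (hij : i ≠ j),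
    toDowlingFrame.pt i j hij s ∈ toPolymatroid.cl {b i, b j}
  rk_pt : ∀ (s : S) (i j : Fin r) (hij : i ≠ j), rk {toDowlingFrame.pt i j hij s} = 1
  rk_basis_pt : ∀ (s : S) (i j : Fin r) (hij : i ≠ j),
    rk {b i, toDowlingFrame.pt i j hij s} = 2
  coherence : ∀ (s : S) (i j k : Fin r) (hij : i ≠ j) (hjk : j ≠ k) (hki : k ≠ i),
    rk {toDowlingFrame.pt i j hij s, toDowlingFrame.pt j k hjk (inv s),
      toDowlingFrame.pt k i hki e} = 2

namespace PartialDowlingGeometry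

variable {r : ℕ} {E S : Type*}

/-- `(s, s', s'')` is a relator: `s_{i,j}, s'_{j,k}, s''_{k,i}` are collinear for all distinct
indices `i, j, k`. -/
def IsRelator (P : PartialDowlingGeometry r E S) (s s' s'' : S) : Prop :=
  ∀ (i j k : Fin r) (hij : i ≠ j) (hjk : j ≠ k) (hki : k ≠ i),
    P.rk {P.pt i j hij s, P.pt j k hjk s', P.pt k i hki s''} = 2

/-- `t` is a geometric product of `s` and `s'`. -/
def IsGeometricProduct (P : PartialDowlingGeometry r E S) (s s' t : S) : Prop :=
  P.IsRelator s s' (P.inv t)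

/-- Every two generators have a geometric product in the generating set. -/
def ClosedUnderGeometricProducts (P : PartialDowlingGeometry r E S) : Prop :=
  ∀ s s' : S, ∃ t : S, P.IsGeometricProduct s s' t

/-- The parallelism relation on generators: `t'_{i,j} ∈ cl (t_{i,j})` for some indices. -/
def Parallel (P : PartialDowlingGeometry r E S) (t t' : S) : Prop :=
  ∃ (i j : Fin r) (hij : i ≠ j), P.pt i j hij t' ∈ P.cl {P.pt i j hij t}

end PartialDowlingGeometry

/-! ### Closure and submodularity in polymatroids. -/

namespace Polymatroid

variable {E : Type*} (M : Polymatroid E)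

/-! The argument is synthetic incidence geometry, with submodularity replacing the intersection of
flats. If a set `A` gains at least one unit of rank when `b i` and `b j` are adjoined, two points
`s_{i,j}`, `t_{i,j}` in its closure have joint rank at most `1`, hence are parallel
(`parallelAt_of_mem_cl`). In a plane, with `A` a pair of points on two sides of a triangle, this
gives uniqueness of products and, via the relators `(s, e, s⁻¹)`, carries parallelism from line to
line. In rank 4, with `A` three points along a path `i, j, k, l`, it gives associativity: both
bracketings lie in the closure of `A`. Existence of products is the closedness hypothesis; identity
and inverses come from coherence. -/

theorem mem_cl_of_rk_le {A : Set E} {x : E} (h : M.rk (A ∪ {x}) ≤ M.rk A) : x ∈ M.cl A :=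
  le_antisymm (M.rk_mono _ _ Set.subset_union_left) h

theorem subset_cl (A : Set E) : A ⊆ M.cl A := fun x hx => by
  have : A ∪ {x} = A := Set.union_eq_self_of_subset_right (Set.singleton_subset_iff.2 hx)
  exact congrArg M.rk this.symm

theorem cl_mono {A B : Set E} (h : A ⊆ B) : M.cl A ⊆ M.cl B := fun x hx => by
  apply M.mem_cl_of_rk_le
  have h1 := M.rk_submodular B (A ∪ {x})
  have h2 : B ∪ (A ∪ {x}) = B ∪ {x} := by
    rw [← Set.union_assoc, Set.union_eq_self_of_subset_right h]
  have h3 := M.rk_mono A (B ∩ (A ∪ {x})) (Set.subset_inter h Set.subset_union_left)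
  have h4 : M.rk A = M.rk (A ∪ {x}) := hx
  rw [h2] at h1
  linarith

/-- Closure only controls adjoining a single element, so `T` is added point by point; hence the
finiteness assumption. -/
theorem rk_union_of_subset_cl {A T : Set E} (hT : T.Finite) (h : T ⊆ M.cl A) :
    M.rk (A ∪ T) = M.rk A := by
  induction T, hT using Set.Finite.induction_on with
  | empty => rw [Set.union_empty]
  | @insert a T _ _ ih =>
    have h1 : M.rk (A ∪ T) = M.rk (A ∪ T ∪ {a}) :=
      M.cl_mono Set.subset_union_left (h (Set.mem_insert a T))
    rw [← ih fun x hx => h (Set.mem_insert_of_mem a hx), h1, Set.union_assoc,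
      Set.union_singleton]

theorem rk_le_of_subset_cl {A T : Set E} (hT : T.Finite) (h : T ⊆ M.cl A) :
    M.rk T ≤ M.rk A :=
  (M.rk_mono _ _ Set.subset_union_right).trans (M.rk_union_of_subset_cl hT h).le

theorem mem_cl_trans {A T : Set E} {x : E} (hT : T.Finite) (h : T ⊆ M.cl A) (hx : x ∈ M.cl T) :
    x ∈ M.cl A := by
  apply M.mem_cl_of_rk_le
  have h1 : M.rk (A ∪ T) = M.rk (A ∪ T ∪ {x}) := M.cl_mono Set.subset_union_right hx
  rw [← M.rk_union_of_subset_cl hT h, h1]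
  exact M.rk_mono _ _ (Set.union_subset_union_left _ Set.subset_union_left)

/-- Submodularity for `A ∪ X` and `B ∪ X`, which have the ranks of `A` and `B`: it bounds the rank
of what two flats share. -/
theorem rk_add_rk_union_le {A B X : Set E} (hX : X.Finite) (hA : X ⊆ M.cl A)
    (hB : X ⊆ M.cl B) : M.rk X + M.rk (A ∪ B) ≤ M.rk A + M.rk B := by
  have h1 := M.rk_submodular (A ∪ X) (B ∪ X)
  have h2 := M.rk_mono X ((A ∪ X) ∩ (B ∪ X))
    (Set.subset_inter Set.subset_union_right Set.subset_union_right)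
  have h3 := M.rk_mono (A ∪ B) ((A ∪ X) ∪ (B ∪ X))
    (Set.union_subset_union Set.subset_union_left Set.subset_union_left)
  rw [M.rk_union_of_subset_cl hX hA, M.rk_union_of_subset_cl hX hB] at h1
  linarith

theorem rk_union_le (A B : Set E) : M.rk (A ∪ B) ≤ M.rk A + M.rk B := by
  have h1 := M.rk_submodular A B
  have h2 := M.rk_mono ∅ (A ∩ B) (Set.empty_subset _)
  rw [M.rk_empty] at h2
  linarith

theorem rk_insert_le (x : E) (A : Set E) : M.rk (insert x A) ≤ M.rk {x} + M.rk A := by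
  rw [Set.insert_eq]
  exact M.rk_union_le _ _

end Polymatroid

/-! ### Basis points and rank computations. -/

theorem DowlingFrame.b_injective {r : ℕ} {E S : Type*} (D : DowlingFrame r E S) :
    Function.Injective D.b := fun _ _ h =>
  Sum.inl_injective (D.bijective_elim.1 h)

theorem DowlingFrame.pt_symm {r : ℕ} {E S : Type*} (D : DowlingFrame r E S) {i j : Fin r}
    (hij : i ≠ j) (s : S) : D.pt j i hij.symm (D.inv s) = D.pt i j hij s := by
  rcases lt_or_gt_of_ne hij with h | h
  · simp only [DowlingFrame.pt, dif_pos h, dif_neg h.not_gt, D.inv_involutive s]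
  · simp only [DowlingFrame.pt, dif_pos h, dif_neg h.not_gt]

namespace PartialDowlingGeometry

variable {r : ℕ} {E S : Type*} (P : PartialDowlingGeometry r E S)

theorem rk_image_b (I : Finset (Fin r)) : P.rk (P.b '' I) = I.card := by
  rw [P.rk_basis _ (Set.image_subset_range _ _), Set.ncard_image_of_injective _ P.b_injective,
    Set.ncard_coe_finset]

/-- The source of lower bounds on rank: recover enough basis points in the closure. -/
theorem card_le_rk {A : Set E} (I : Finset (Fin r)) (h : ∀ i ∈ I, P.b i ∈ P.cl A) :
    (I.card : ℝ) ≤ P.rk A := by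
  rw [← P.rk_image_b]
  apply P.rk_le_of_subset_cl (I.finite_toSet.image _)
  rintro _ ⟨i, hi, rfl⟩
  exact h i hi

theorem rk_b (i : Fin r) : P.rk {P.b i} = 1 := by
  simpa using P.rk_image_b {i}

theorem rk_b_pair {i j : Fin r} (hij : i ≠ j) : P.rk {P.b i, P.b j} = 2 := by
  simpa [Set.image_insert_eq, Finset.card_pair hij] using P.rk_image_b {i, j}

theorem b_mem_cl {i j : Fin r} (hij : i ≠ j) (s : S) :
    P.b j ∈ P.cl {P.b i, P.pt i j hij s} := by
  apply P.mem_cl_of_rk_le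
  have h1 : P.rk {P.b i, P.b j} = P.rk ({P.b i, P.b j} ∪ {P.pt i j hij s}) :=
    P.pt_mem_cl s i j hij
  rw [P.rk_basis_pt, show ({P.b i, P.pt i j hij s} ∪ {P.b j} : Set E) =
    {P.b i, P.b j} ∪ {P.pt i j hij s} by ext; simp; tauto, ← h1, P.rk_b_pair hij]

theorem b_mem_cl_of_mem {A : Set E} {i j : Fin r} {hij : i ≠ j} {s : S} (hi : P.b i ∈ P.cl A)
    (hs : P.pt i j hij s ∈ A) : P.b j ∈ P.cl A := by
  refine P.mem_cl_trans (Set.toFinite {P.b i, P.pt i j hij s}) ?_ (P.b_mem_cl hij s)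
  rintro x (rfl | rfl)
  · exact hi
  · exact P.subset_cl _ hs

theorem b_mem_cl_of_mem' {A : Set E} {i j : Fin r} {hij : i ≠ j} {s : S} (hj : P.b j ∈ P.cl A)
    (hs : P.pt i j hij s ∈ A) : P.b i ∈ P.cl A := by
  rw [← P.pt_symm] at hs
  exact P.b_mem_cl_of_mem hj hs

/-- For the lower bound, adjoining `b j` costs at most `1` and recovers `b i` and `b k`, so the
result has rank at least `3`. -/
theorem rk_pt_pair {i j k : Fin r} (hij : i ≠ j) (hjk : j ≠ k) (hki : k ≠ i) (s t : S) :
    P.rk {P.pt i j hij s, P.pt j k hjk t} = 2 := by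
  apply le_antisymm
  · have := P.rk_insert_le (P.pt i j hij s) {P.pt j k hjk t}
    rw [P.rk_pt, P.rk_pt] at this
    linarith
  · have h1 := P.rk_insert_le (P.b j) {P.pt i j hij s, P.pt j k hjk t}
    rw [P.rk_b] at h1
    have hj : P.b j ∈ P.cl {P.b j, P.pt i j hij s, P.pt j k hjk t} := P.subset_cl _ (by simp)
    have hi := P.b_mem_cl_of_mem' (i := i) (hij := hij) (s := s) hj (by simp)
    have hk := P.b_mem_cl_of_mem (j := k) (hij := hjk) (s := t) hj (by simp)
    have h2 := P.card_le_rk (A := {P.b j, P.pt i j hij s, P.pt j k hjk t}) {i, j, k}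
      (by
        simp only [Finset.mem_insert, Finset.mem_singleton]
        rintro _ (rfl | rfl | rfl) <;> assumption)
    rw [Finset.card_eq_three.2 ⟨i, j, k, hij, hki.symm, hjk, rfl⟩] at h2
    push_cast at h2
    linarith

/-- `s` and `t` are parallel in the copy of the generating set on the line through `b i`, `b j`. -/
def ParallelAt (i j : Fin r) (hij : i ≠ j) (s t : S) : Prop :=
  P.pt i j hij t ∈ P.cl {P.pt i j hij s}

/-! ### Parallelism and relators. -/

variable {P}

theorem ParallelAt.inv {i j : Fin r} {hij : i ≠ j} {s t : S} (h : P.ParallelAt i j hij s t) :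
    P.ParallelAt j i hij.symm (P.inv s) (P.inv t) := by
  rwa [ParallelAt, P.pt_symm, P.pt_symm]

theorem parallelAt_inv_iff {i j : Fin r} {hij : i ≠ j} {s t : S} :
    P.ParallelAt j i hij.symm (P.inv s) (P.inv t) ↔ P.ParallelAt i j hij s t := by
  rw [ParallelAt, P.pt_symm, P.pt_symm, ParallelAt]

theorem ParallelAt.symm {i j : Fin r} {hij : i ≠ j} {s t : S} (h : P.ParallelAt i j hij s t) :
    P.ParallelAt i j hij t s := by
  apply P.mem_cl_of_rk_le
  have h1 : P.rk {P.pt i j hij s} = P.rk ({P.pt i j hij s} ∪ {P.pt i j hij t}) := h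
  rw [Set.union_comm, ← h1, P.rk_pt, P.rk_pt]

theorem ParallelAt.trans {i j : Fin r} {hij : i ≠ j} {s t u : S}
    (h : P.ParallelAt i j hij s t) (h' : P.ParallelAt i j hij t u) :
    P.ParallelAt i j hij s u :=
  P.mem_cl_trans (Set.finite_singleton _) (Set.singleton_subset_iff.2 h) h'

/-- Two points of the line through `b i`, `b j` in a common flat that misses this line are
parallel. -/
theorem parallelAt_of_mem_cl {i j : Fin r} {hij : i ≠ j} {s t : S} {A : Set E}
    (hA : P.rk A + 1 ≤ P.rk (A ∪ {P.b i, P.b j})) (hs : P.pt i j hij s ∈ P.cl A)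
    (ht : P.pt i j hij t ∈ P.cl A) : P.ParallelAt i j hij s t := by
  apply P.mem_cl_of_rk_le
  -- The pair has rank at most `rk A + 2 - rk (A ∪ {b i, b j}) ≤ 1`, the rank of either point.
  have h1 := P.rk_add_rk_union_le (A := A) (B := {P.b i, P.b j})
    (Set.toFinite ({P.pt i j hij s} ∪ {P.pt i j hij t}))
    (by rintro x (rfl | rfl) <;> assumption)
    (by rintro x (rfl | rfl) <;> exact P.pt_mem_cl _ _ _ _)
  rw [P.rk_b_pair hij] at h1
  rw [P.rk_pt]
  linarith

theorem IsRelator.rotate {s t u : S} (h : P.IsRelator s t u) : P.IsRelator t u s := by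
  intro i j k hij hjk hki
  have := h k i j hki hij hjk
  rwa [Set.insert_comm, Set.pair_comm] at this

theorem IsRelator.mem_cl {s t u : S} (h : P.IsRelator s t u) {i j k : Fin r} (hij : i ≠ j)
    (hjk : j ≠ k) (hki : k ≠ i) :
    P.pt k i hki u ∈ P.cl {P.pt i j hij s, P.pt j k hjk t} := by
  apply P.mem_cl_of_rk_le
  rw [P.rk_pt_pair hij hjk hki, ← h i j k hij hjk hki]
  apply le_of_eq
  congr 1
  ext
  simp
  tauto

theorem isRelator_of_mem_cl {s t u : S}
    (h : ∀ (i j k : Fin r) (hij : i ≠ j) (hjk : j ≠ k) (hki : k ≠ i),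
      P.pt k i hki u ∈ P.cl {P.pt i j hij s, P.pt j k hjk t}) : P.IsRelator s t u := by
  intro i j k hij hjk hki
  have h1 : P.rk {P.pt i j hij s, P.pt j k hjk t} =
    P.rk ({P.pt i j hij s, P.pt j k hjk t} ∪ {P.pt k i hki u}) := h i j k hij hjk hki
  rw [← P.rk_pt_pair hij hjk hki s t, h1]
  congr 1
  ext
  simp
  tauto

variable (P) in
theorem isRelator_inv (s : S) : P.IsRelator s (P.inv s) P.e := P.coherence s

theorem rk_add_one_le_of_pts {i j k : Fin r} (hij : i ≠ j) (hjk : j ≠ k) (hki : k ≠ i)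
    (s t : S) : P.rk {P.pt i j hij s, P.pt j k hjk t} + 1 ≤
      P.rk ({P.pt i j hij s, P.pt j k hjk t} ∪ {P.b k, P.b i}) := by
  rw [P.rk_pt_pair hij hjk hki]
  have hk : P.b k ∈ P.cl ({P.pt i j hij s, P.pt j k hjk t} ∪ {P.b k, P.b i}) :=
    P.subset_cl _ (by simp)
  have hi : P.b i ∈ P.cl ({P.pt i j hij s, P.pt j k hjk t} ∪ {P.b k, P.b i}) :=
    P.subset_cl _ (by simp)
  have hj := P.b_mem_cl_of_mem (j := j) (hij := hij) (s := s) hi (by simp)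
  have h2 := P.card_le_rk (A := {P.pt i j hij s, P.pt j k hjk t} ∪ {P.b k, P.b i}) {i, j, k}
      (by
        simp only [Finset.mem_insert, Finset.mem_singleton]
        rintro _ (rfl | rfl | rfl) <;> assumption)
  rw [Finset.card_eq_three.2 ⟨i, j, k, hij, hki.symm, hjk, rfl⟩] at h2
  push_cast at h2
  linarith

/-- Projection from `t_{j,k}`: both `u` and `u'` lie in the closure of `s_{i,j}, t_{j,k}`, which
meets the line through `b k`, `b i` in one parallelism class. -/
theorem ParallelAt.of_isRelator {s s' t u u' : S} {i j k : Fin r} {hij : i ≠ j}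
    (h : P.ParallelAt i j hij s s') (hjk : j ≠ k) (hki : k ≠ i)
    (hu : P.IsRelator s t u) (hu' : P.IsRelator s' t u') : P.ParallelAt k i hki u u' := by
  refine parallelAt_of_mem_cl (rk_add_one_le_of_pts hij hjk hki s t) (hu.mem_cl hij hjk hki)
    (P.mem_cl_trans (Set.toFinite _) ?_ (hu'.mem_cl hij hjk hki))
  rintro x (rfl | rfl)
  · exact P.cl_mono (by simp) h
  · exact P.subset_cl _ (by simp)

variable (P) in
theorem isRelator_e_inv (s : S) : P.IsRelator s P.e (P.inv s) := by
  have h := P.isRelator_inv (P.inv s)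
  rw [P.inv_involutive] at h
  exact h.rotate

/-- Projection from `e_{j,k}` sends `s_{i,j}` to `s_{i,k}`. -/
theorem ParallelAt.change_snd {s t : S} {i j k : Fin r} {hij : i ≠ j}
    (h : P.ParallelAt i j hij s t) (hik : i ≠ k) : P.ParallelAt i k hik s t := by
  by_cases hjk : j = k
  · subst hjk
    exact h
  · exact parallelAt_inv_iff.1
      (h.of_isRelator hjk hik.symm (P.isRelator_e_inv s) (P.isRelator_e_inv t))

theorem ParallelAt.change_fst {s t : S} {i j k : Fin r} {hij : i ≠ j}
    (h : P.ParallelAt i j hij s t) (hkj : k ≠ j) : P.ParallelAt k j hkj s t :=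
  parallelAt_inv_iff.1 (h.inv.change_snd hkj.symm)

theorem Parallel.parallelAt (hr : 3 ≤ r) {s t : S} (h : P.Parallel s t) (p q : Fin r)
    (hpq : p ≠ q) : P.ParallelAt p q hpq s t := by
  obtain ⟨i, j, hij, h⟩ := h
  change P.ParallelAt i j hij s t at h
  by_cases hpj : p = j
  · subst hpj
    obtain ⟨k, hk⟩ : ∃ k, k ∉ ({i, p} : Finset (Fin r)) := by
      by_contra! hall
      have h1 : ({i, p} : Finset (Fin r)) = Finset.univ := Finset.eq_univ_iff_forall.2 hall
      have h2 := (congrArg Finset.card h1).symm.le.trans Finset.card_le_two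
      rw [Finset.card_univ, Fintype.card_fin] at h2
      omega
    simp only [Finset.mem_insert, Finset.mem_singleton, not_or] at hk
    exact ((h.change_snd (Ne.symm hk.1)).change_fst (Ne.symm hk.2)).change_snd hpq
  · exact (h.change_fst hpj).change_snd hpq

theorem Parallel.inv {s t : S} (h : P.Parallel s t) : P.Parallel (P.inv s) (P.inv t) := by
  obtain ⟨i, j, hij, h⟩ := h
  exact ⟨j, i, hij.symm, ParallelAt.inv h⟩

variable (P) in
theorem parallel_equivalence (hr : 3 ≤ r) : Equivalence P.Parallel where
  refl s := ⟨⟨0, by omega⟩, ⟨1, by omega⟩, by simp, P.subset_cl _ rfl⟩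
  symm := by
    rintro s t ⟨i, j, hij, h⟩
    exact ⟨i, j, hij, ParallelAt.symm h⟩
  trans := by
    rintro s t u ⟨i, j, hij, h⟩ h'
    exact ⟨i, j, hij, ParallelAt.trans h (h'.parallelAt hr i j hij)⟩

theorem IsRelator.congr_right (hr : 3 ≤ r) {s t u u' : S} (h : P.IsRelator s t u)
    (hu : P.Parallel u u') : P.IsRelator s t u' :=
  isRelator_of_mem_cl fun _ _ _ hij hjk hki =>
    P.mem_cl_trans (Set.finite_singleton _) (Set.singleton_subset_iff.2 (h.mem_cl hij hjk hki))
      (hu.parallelAt hr _ _ hki)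

theorem IsRelator.congr (hr : 3 ≤ r) {s s' t t' u u' : S} (h : P.IsRelator s t u)
    (hs : P.Parallel s s') (ht : P.Parallel t t') (hu : P.Parallel u u') :
    P.IsRelator s' t' u' :=
  (((h.congr_right hr hu).rotate.congr_right hr hs).rotate.congr_right hr ht).rotate

/-- Projection of a point that is trivially parallel to itself. -/
theorem IsRelator.parallel (hr : 3 ≤ r) {s t u u' : S} (h : P.IsRelator s t u)
    (h' : P.IsRelator s t u') : P.Parallel u u' :=
  ⟨_, _, _, ParallelAt.of_isRelator (i := ⟨0, by omega⟩) (j := ⟨1, by omega⟩)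
    (k := ⟨2, by omega⟩) (hij := by simp) (P.subset_cl _ rfl) (by simp) (by simp) h h'⟩

/-! ### Geometric products and the group. -/

theorem IsGeometricProduct.congr (hr : 3 ≤ r) {s s' t t' u u' : S}
    (h : P.IsGeometricProduct s t u) (hs : P.Parallel s s') (ht : P.Parallel t t')
    (hu : P.Parallel u u') : P.IsGeometricProduct s' t' u' :=
  IsRelator.congr hr h hs ht hu.inv

theorem IsGeometricProduct.parallel (hr : 3 ≤ r) {s t u u' : S}
    (h : P.IsGeometricProduct s t u) (h' : P.IsGeometricProduct s t u') : P.Parallel u u' := by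
  simpa only [P.inv_involutive _] using (IsRelator.parallel hr h h').inv

theorem IsGeometricProduct.mem_cl {s t u : S} (h : P.IsGeometricProduct s t u) {i j k : Fin r}
    (hij : i ≠ j) (hjk : j ≠ k) (hik : i ≠ k) :
    P.pt i k hik u ∈ P.cl {P.pt i j hij s, P.pt j k hjk t} := by
  rw [← P.pt_symm hik]
  exact IsRelator.mem_cl h hij hjk hik.symm

variable (P) in
theorem isGeometricProduct_inv_left (s : S) : P.IsGeometricProduct (P.inv s) s P.e := by
  have h := P.isRelator_inv (P.inv s)
  rwa [P.inv_involutive, ← P.inv_e] at h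

variable (P) in
theorem isGeometricProduct_e_left (s : S) : P.IsGeometricProduct P.e s s :=
  (P.isRelator_inv s).rotate.rotate

/-- Both products lie on the line through `b i`, `b l` and in the closure of three points of rank at
most `3`; adjoining `b i`, `b l` recovers all four basis points, so the rank rises to at least `4`.
-/
theorem IsGeometricProduct.assoc (hr : 4 ≤ r) {s t u st tu v v' : S}
    (hst : P.IsGeometricProduct s t st) (htu : P.IsGeometricProduct t u tu)
    (hv : P.IsGeometricProduct st u v) (hv' : P.IsGeometricProduct s tu v') :
    P.Parallel v v' := by
  obtain ⟨i, j, k, l, hij, hjk, hkl, hik, hil, hjl⟩ : ∃ i j k l : Fin r,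
      i ≠ j ∧ j ≠ k ∧ k ≠ l ∧ i ≠ k ∧ i ≠ l ∧ j ≠ l :=
    ⟨⟨0, by omega⟩, ⟨1, by omega⟩, ⟨2, by omega⟩, ⟨3, by omega⟩, by simp⟩
  set A : Set E := {P.pt i j hij s, P.pt j k hjk t, P.pt k l hkl u} with hAdef
  have hs : P.pt i j hij s ∈ P.cl A := P.subset_cl _ (by simp [hAdef])
  have ht : P.pt j k hjk t ∈ P.cl A := P.subset_cl _ (by simp [hAdef])
  have hu : P.pt k l hkl u ∈ P.cl A := P.subset_cl _ (by simp [hAdef])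
  have hcl {x y z : E} (hx : x ∈ P.cl A) (hy : y ∈ P.cl A) (hz : z ∈ P.cl {x, y}) :
      z ∈ P.cl A :=
    P.mem_cl_trans (Set.toFinite _) (by rintro _ (rfl | rfl) <;> assumption) hz
  have hrank : P.rk A + 1 ≤ P.rk (A ∪ {P.b i, P.b l}) := by
    have h1 := P.rk_insert_le (P.pt i j hij s) {P.pt j k hjk t, P.pt k l hkl u}
    rw [P.rk_pt, P.rk_pt_pair hjk hkl hjl.symm] at h1
    have hi : P.b i ∈ P.cl (A ∪ {P.b i, P.b l}) := P.subset_cl _ (by simp)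
    have hl : P.b l ∈ P.cl (A ∪ {P.b i, P.b l}) := P.subset_cl _ (by simp)
    have hj := P.b_mem_cl_of_mem (j := j) (hij := hij) (s := s) hi (by simp [hAdef])
    have hk := P.b_mem_cl_of_mem (j := k) (hij := hjk) (s := t) hj (by simp [hAdef])
    have h2 := P.card_le_rk (A := A ∪ {P.b i, P.b l}) {i, j, k, l}
      (by
        simp only [Finset.mem_insert, Finset.mem_singleton]
        rintro _ (rfl | rfl | rfl | rfl) <;> assumption)
    rw [Finset.card_insert_of_notMem (by simp [*]),
      Finset.card_eq_three.2 ⟨j, k, l, hjk, hjl, hkl, rfl⟩] at h2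
    push_cast at h2
    linarith
  exact ⟨i, l, hil, parallelAt_of_mem_cl hrank
    (hcl (hcl hs ht (hst.mem_cl hij hjk hik)) hu (hv.mem_cl hik hkl hil))
    (hcl hs (hcl ht hu (htu.mem_cl hjk hkl hjl)) (hv'.mem_cl hij hjl hil))⟩

variable (P) in
/-- The group of parallelism classes under the geometric product. -/
noncomputable abbrev parallelGroup (hr : 4 ≤ r) (hclosed : P.ClosedUnderGeometricProducts)
    (hpar : Equivalence P.Parallel) : Group (Quotient (Setoid.mk P.Parallel hpar)) :=
  letI : Mul (Quotient (Setoid.mk P.Parallel hpar)) :=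
    ⟨Quotient.lift₂ (fun s t => Quotient.mk _ (hclosed s t).choose)
      fun s t _ _ hs ht => Quotient.sound <|
        ((hclosed s t).choose_spec.congr (by omega) hs ht (hpar.refl _)).parallel (by omega)
          (hclosed _ _).choose_spec⟩
  letI : One (Quotient (Setoid.mk P.Parallel hpar)) := ⟨Quotient.mk _ P.e⟩
  letI : Inv (Quotient (Setoid.mk P.Parallel hpar)) :=
    ⟨Quotient.map P.inv fun _ _ h => Parallel.inv h⟩
  -- Products are chosen representatives, so each axiom reduces to uniqueness up to parallelism.
  Group.ofLeftAxioms
    (by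
      rintro ⟨s⟩ ⟨t⟩ ⟨u⟩
      exact Quotient.sound (IsGeometricProduct.assoc hr (hclosed _ _).choose_spec
        (hclosed _ _).choose_spec (hclosed _ _).choose_spec (hclosed _ _).choose_spec))
    (by
      rintro ⟨s⟩
      exact Quotient.sound ((hclosed _ _).choose_spec.parallel (by omega)
        (P.isGeometricProduct_e_left s)))
    (by
      rintro ⟨s⟩
      exact Quotient.sound ((hclosed _ _).choose_spec.parallel (by omega)
        (P.isGeometricProduct_inv_left s)))

end PartialDowlingGeometry

/-- For an almost entropic PDG of rank 4 closed under geometric products, parallelism is an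
equivalence relation, the geometric product descends to the parallelism classes, and they form a
group under it, in which the inverse of `[s]` is `[s⁻¹]`. -/
theorem mainTheorem4 {E S : Type*} (P : PartialDowlingGeometry 4 E S)
    (hP : P.IsAlmostEntropic) (hclosed : P.ClosedUnderGeometricProducts) :
    ∃ (hpar : Equivalence P.Parallel) (_ : Group (Quotient (Setoid.mk P.Parallel hpar))),
      (∀ s s' t : S, P.IsGeometricProduct s s' t ↔
        Quotient.mk (Setoid.mk P.Parallel hpar) s * Quotient.mk (Setoid.mk P.Parallel hpar) s' =
          Quotient.mk (Setoid.mk P.Parallel hpar) t) ∧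
      ∀ s : S, (Quotient.mk (Setoid.mk P.Parallel hpar) s)⁻¹ =
        Quotient.mk (Setoid.mk P.Parallel hpar) (P.inv s) := by
  have hpar := P.parallel_equivalence (by norm_num)
  refine ⟨hpar, P.parallelGroup le_rfl hclosed hpar, fun s s' t => ⟨fun h => ?_, fun h => ?_⟩,
    fun s => rfl⟩
  · exact Quotient.sound ((hclosed s s').choose_spec.parallel (by norm_num) h)
  -- The chosen product is parallel to `t`, and relators are stable under parallelism.
  · exact (hclosed s s').choose_spec.congr (by norm_num) (hpar.refl _) (hpar.refl _)
      (Quotient.exact h)
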